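/- Let $\mathbb T=\mathbb R/2\pi\mathbb Z$ with the normalised measure $\frac{dx}{2\pi}$, and let $L^2$, $L^4$ be the spaces of complex-valued functions on $\mathbb T$ with respect to it, so that $\|u\|_{L^2}^2=\sum_{n\in\mathbb Z}|u(n)|^2$, where $u(n)=\frac1{2\pi}\int_{\mathbb T}u(x)e^{-inx}\,dx$. Let $\Pi_N u=\sum_{|n|\le N}u(n)e^{inx}$. For $\alpha>1/2$ let $\gamma_\alpha$ be the law on $L^2(\mathbb T)$ (with its Borel $\sigma$-algebra) of the random Fourier series $$\sum_{n\in\mathbb Z}\frac{g_n}{(1+|n|^{2\alpha})^{1/2}}\,e^{inx},$$ where the $g_n$ are independent standard complex Gaussian variables (centred, with independent real and imaginary parts of variance $1/2$, so that $E|g_n|^2=1$). Let $E_\alpha$ be the expectation with respect to $\gamma_\alpha$, and for $R>0$ let $\tilde\gamma_\alpha(A)=\gamma_\alpha(A\cap\{\|u\|_{L^2}\le R\})$ for Borel sets $A\subseteq L^2(\mathbb T)$. Let $\alpha>3/4$, $\lambda\in\mathbb R$ and $R>0$. Then there is a constant $C=C(\alpha,\lambda,R)<\infty$ such that for all $N\in\mathbb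 N=\{0,1,2,\dots\}$ $$E_\alpha\Big[1_{\{\|\Pi_N u\|_{L^2}\le R\}}\,e^{\lambda\|\Pi_N u\|_{L^4}^4}\Big]\le C .$$ Moreover $u\in L^4(\mathbb T)$ for $\tilde\gamma_\alpha$-almost every $u$, and $u\mapsto e^{\lambda\|u\|_{L^4}^4}$ is integrable with respect to $\tilde\gamma_\alpha$; in particular (take $\lambda=\frac12$) the density $e^{\frac12\|u\|_{L^4}^4}$ of the focusing Gibbs measure is $\tilde\gamma_\alpha$-integrable. -/

import Mathlib

open MeasureTheory ProbabilityTheory Filter Topology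
open scoped ENNReal NNReal

namespace FractionalNLS

noncomputable section

instance fact_two_pi_pos : Fact (0 < 2 * Real.pi) := ⟨Real.two_pi_pos⟩

/-- The torus `ℝ / 2πℤ`. -/
abbrev Torus : Type := AddCircle (2 * Real.pi)

/-- The normalised measure `dx / 2π` on the torus. -/
abbrev torusMeasure : Measure Torus := AddCircle.haarAddCircle

/-- The complex space `L²(𝕋)`; with the normalised measure, `‖u‖² = ∑ₙ |u(n)|²`. -/
abbrev L2 : Type := Lp ℂ 2 torusMeasure

/-- `L²(𝕋)` carries its Borel σ-algebra. -/
instance measurableSpaceL2 : MeasurableSpace L2 := borel L2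

instance borelSpaceL2 : BorelSpace L2 := ⟨rfl⟩

/-- The standard complex Gaussian law: centred, real and imaginary parts independent, each of
variance `1/2`, so that `E|g|² = 1`. -/
def complexGaussian : Measure ℂ :=
  ((gaussianReal 0 (1 / 2)).prod (gaussianReal 0 (1 / 2))).map
    (fun p : ℝ × ℝ => (p.1 : ℂ) + (p.2 : ℂ) * Complex.I)

instance isProbabilityMeasure_complexGaussian : IsProbabilityMeasure complexGaussian :=
  Measure.isProbabilityMeasure_map (by fun_prop)

/-- The law of a family `(gₙ)`, `n ∈ ℤ`, of independent standard complex Gaussians. -/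
def gaussianSequence : Measure (ℤ → ℂ) := Measure.infinitePi (fun _ : ℤ => complexGaussian)

instance isProbabilityMeasure_gaussianSequence : IsProbabilityMeasure gaussianSequence := by
  unfold gaussianSequence; infer_instance

/-- The weight `(1 + |n|^{2α})^{1/2}`. -/
def weight (α : ℝ) (n : ℤ) : ℝ := Real.sqrt (1 + |(n : ℝ)| ^ (2 * α))

/-- The random Fourier series `∑ₙ gₙ (1 + |n|^{2α})^{-1/2} e^{inx}`, as an element of `L²(𝕋)`.
For `α > 1/2` it converges in `L²(𝕋)` for almost every `g`. -/
def randomSeries (α : ℝ) (g : ℤ → ℂ) : L2 :=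
  ∑' n : ℤ, (g n / (weight α n : ℂ)) • (fourierLp 2 n : L2)

/-- The Gaussian measure `γ_α` on `L²(𝕋)`: the law of the random Fourier series. -/
def gamma (α : ℝ) : Measure L2 := gaussianSequence.map (randomSeries α)

/-- The restriction `γ̃_α` of `γ_α` to the ball `{‖u‖_{L²} ≤ R}` (not renormalised). -/
def gammaTilde (α R : ℝ) : Measure L2 := (gamma α).restrict {u : L2 | ‖u‖ ≤ R}

/-- The orthogonal projection `Π_N u = ∑_{|n| ≤ N} u(n) e^{inx}`. -/
def proj (N : ℕ) (u : L2) : L2 :=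
  ∑ n ∈ Finset.Icc (-(N : ℤ)) (N : ℤ), fourierCoeff u n • (fourierLp 2 n : L2)

/-- The `L⁴(𝕋)` norm (meaningful when `u ∈ L⁴(𝕋)`, in particular for trigonometric polynomials). -/
def normL4 (u : L2) : ℝ := (eLpNorm u 4 torusMeasure).toReal

/-! The series converges almost surely and `γ_α` is a probability measure when `α > 1/2`. -/

theorem lintegral_complexGaussian_lt_top :
    ∫⁻ z, ‖z‖ₑ ^ 2 ∂complexGaussian < ∞ := by
  have h1 : MemLp (fun x : ℝ => x) 2 (gaussianReal 0 (1 / 2)) :=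
    memLp_id_gaussianReal' 2 (by simp)
  have h2 : MemLp (fun p : ℝ × ℝ => (p.1 : ℂ) + (p.2 : ℂ) * Complex.I) 2
      ((gaussianReal 0 (1 / 2)).prod (gaussianReal 0 (1 / 2))) := by
    have a := (h1.comp_fst (gaussianReal 0 (1 / 2))).ofReal (K := ℂ)
    have b := (h1.comp_snd (gaussianReal 0 (1 / 2))).ofReal (K := ℂ)
    exact a.add (b.mul_const Complex.I)
  have h3 := h2.eLpNorm_lt_top
  rw [eLpNorm_lt_top_iff_lintegral_rpow_enorm_lt_top (by simp) (by simp)] at h3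
  rw [complexGaussian, lintegral_map (by fun_prop) (by fun_prop)]
  simpa using h3

theorem summable_weight {α : ℝ} (hα : 1 / 2 < α) :
    Summable fun n : ℤ => 1 / (weight α n) ^ 2 := by
  have hs : Summable fun n : ℤ => |(n : ℝ)| ^ (-(2 * α)) :=
    Real.summable_abs_int_rpow (by linarith)
  refine (hs.add (hasSum_ite_eq (0 : ℤ) (1 : ℝ)).summable).of_nonneg_of_le
    (fun n => by positivity) (fun n => ?_)
  have h0 : 0 ≤ |(n : ℝ)| ^ (2 * α) := by positivity
  rw [weight, Real.sq_sqrt (by positivity)]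
  by_cases hn : n = 0
  · subst hn
    rw [div_le_iff₀ (by positivity)]
    have : (0 : ℝ) ^ (2 * α) = 0 := Real.zero_rpow (by linarith)
    have : (0 : ℝ) ≤ 0 ^ (-(2 * α)) := by positivity
    simp_all
  · have hp : 0 < |(n : ℝ)| ^ (2 * α) := by positivity
    simp only [hn, if_false, add_zero]
    rw [Real.rpow_neg (by positivity), one_div]
    exact inv_anti₀ hp (by linarith)

theorem ae_summable {α : ℝ} (hα : 1 / 2 < α) :
    ∀ᵐ g ∂gaussianSequence,
      Summable fun n : ℤ => (g n / (weight α n : ℂ)) • (fourierLp 2 n : L2) := by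
  have hw : ∀ n, 0 < weight α n := fun n => Real.sqrt_pos.2 (by positivity)
  have hm : ∀ n : ℤ, Measurable fun g : ℤ → ℂ =>
      ENNReal.ofReal (1 / weight α n ^ 2) * ‖g n‖ₑ ^ 2 := fun n =>
    ((measurable_pi_apply n).enorm.pow_const 2).const_mul _
  have key : ∫⁻ g, ∑' n : ℤ, ENNReal.ofReal (1 / weight α n ^ 2) * ‖g n‖ₑ ^ 2
      ∂gaussianSequence ≠ ∞ := by
    rw [lintegral_tsum (fun n => (hm n).aemeasurable)]
    have : ∀ n : ℤ, ∫⁻ g, ENNReal.ofReal (1 / weight α n ^ 2) * ‖g n‖ₑ ^ 2 ∂gaussianSequence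
        = ENNReal.ofReal (1 / weight α n ^ 2) * ∫⁻ z, ‖z‖ₑ ^ 2 ∂complexGaussian := by
      intro n
      rw [lintegral_const_mul _ (by fun_prop)]
      congr 1
      exact (measurePreserving_eval_infinitePi (fun _ : ℤ => complexGaussian) n).lintegral_comp
        (f := fun z : ℂ => ‖z‖ₑ ^ 2) (by fun_prop)
    simp_rw [this]
    rw [ENNReal.tsum_mul_right]
    exact ENNReal.mul_ne_top (summable_weight hα).tsum_ofReal_ne_top
      lintegral_complexGaussian_lt_top.ne
  filter_upwards [ae_lt_top' (AEMeasurable.tsum fun n => (hm n).aemeasurable) key] with g hg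
  have hV := (orthonormal_fourier (T := 2 * Real.pi)).orthogonalFamily
  refine (hV.summable_iff_norm_sq_summable (fun n => g n / (weight α n : ℂ))).2 ?_
  refine (ENNReal.summable_toReal hg.ne).congr (fun n => ?_)
  have := (hw n).le
  rw [ENNReal.toReal_mul, ENNReal.toReal_ofReal (by positivity)]
  simp only [ENNReal.toReal_pow, toReal_enorm, norm_div, Complex.norm_real, Real.norm_eq_abs,
    abs_of_nonneg this]
  ring

theorem aemeasurable_randomSeries {α : ℝ} (hα : 1 / 2 < α) :
    AEMeasurable (randomSeries α) gaussianSequence := by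
  refine aemeasurable_of_tendsto_metrizable_ae (atTop : Filter (Finset ℤ))
    (f := fun s g => ∑ n ∈ s, (g n / (weight α n : ℂ)) • (fourierLp 2 n : L2)) (fun s => ?_) ?_
  · refine Continuous.aemeasurable ?_
    refine continuous_finsetSum _ (fun n _ => ?_)
    exact ((continuous_apply n).div_const _).smul continuous_const
  · filter_upwards [ae_summable hα] with g hg
    exact hg.hasSum

theorem isProbabilityMeasure_gamma {α : ℝ} (hα : 1 / 2 < α) :
    IsProbabilityMeasure (gamma α) :=
  Measure.isProbabilityMeasure_map (aemeasurable_randomSeries hα)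

end

end FractionalNLS

namespace FractionalNLS

/-! Everything rests on a tail bound, uniform in `N`: on the ball `‖Π_N u‖ ≤ R`, the event `‖Π_N
u‖_{L⁴}⁴ > k` has `γ_α`-probability at most `K e^{-βk}`, for every rate `β`. Summing over integers
`k` with `β = |λ| + 1` gives the exponential moment.

For the tail, cut the frequencies at `M` proportional to `k`. By Bernstein the low part has `L⁴`
norm to the fourth at most `(2M+1) R⁴`, a small multiple of `k` (`quartic_trigPoly_le`), so the high
part must have size of order `k`. It is Gaussian, with variance `V = ∑_{|n|>M} (1+|n|^{2α})⁻¹` at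
every point, and a Chernoff bound gives a tail of type `exp(-c √k / V)` (`measure_le_quartic_le`).
This beats every `e^{-βk}` as soon as `√k V → 0`. Since `∑ √|n| (1+|n|^{2α})⁻¹` converges exactly
when `α > 3/4`, one has `√M V → 0`, and `M` is comparable to `k` (`exists_frequency_cutoff`).

For the untruncated `u`, the `L⁴` norm is lower semicontinuous on `L²` and `Π_N u → u`, so the same
tail bound passes to the limit (`gamma_tail_le_of_proj`). -/

/-! ### Exponential moments of complex Gaussian sums -/

theorem lintegral_exp_mul_gaussianReal (v : ℝ≥0) (t : ℝ) :
    ∫⁻ x, ENNReal.ofReal (Real.exp (t * x)) ∂(gaussianReal 0 v)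
      = ENNReal.ofReal (Real.exp (v * t ^ 2 / 2)) := by
  rw [← ofReal_integral_eq_lintegral_ofReal (integrable_exp_mul_gaussianReal t)
    (ae_of_all _ fun _ => (Real.exp_pos _).le)]
  have h := congrFun (mgf_fun_id_gaussianReal (μ := 0) (v := v)) t
  simp only [mgf, zero_mul, zero_add] at h
  rw [h]

theorem lintegral_exp_re_mul_complexGaussian (b : ℂ) :
    ∫⁻ z, ENNReal.ofReal (Real.exp (b * z).re) ∂complexGaussian
      = ENNReal.ofReal (Real.exp (‖b‖ ^ 2 / 4)) := by
  rw [complexGaussian, lintegral_map (by fun_prop) (by fun_prop)]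
  have h : ∀ p : ℝ × ℝ, ENNReal.ofReal (Real.exp (b * ((p.1 : ℂ) + (p.2 : ℂ) * Complex.I)).re)
      = ENNReal.ofReal (Real.exp (b.re * p.1)) * ENNReal.ofReal (Real.exp (-b.im * p.2)) := by
    intro p
    rw [← ENNReal.ofReal_mul (Real.exp_pos _).le, ← Real.exp_add]
    congr 2
    simp
    ring
  simp_rw [h]
  rw [lintegral_prod_mul (f := fun x : ℝ => ENNReal.ofReal (Real.exp (b.re * x)))
    (g := fun y : ℝ => ENNReal.ofReal (Real.exp (-b.im * y))) (by fun_prop) (by fun_prop),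
    lintegral_exp_mul_gaussianReal,
    lintegral_exp_mul_gaussianReal, ← ENNReal.ofReal_mul (Real.exp_pos _).le, ← Real.exp_add]
  congr 2
  rw [← Complex.normSq_eq_norm_sq, Complex.normSq_apply]
  push_cast
  ring

theorem lintegral_exp_re_sum_gaussianSequence (s : Finset ℤ) (b : ℤ → ℂ) :
    ∫⁻ g, ENNReal.ofReal (Real.exp (∑ n ∈ s, b n * g n).re) ∂gaussianSequence
      = ENNReal.ofReal (Real.exp ((∑ n ∈ s, ‖b n‖ ^ 2) / 4)) := by
  have h : ∀ g : ℤ → ℂ, ENNReal.ofReal (Real.exp (∑ n ∈ s, b n * g n).re)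
      = ∏ n ∈ s, ENNReal.ofReal (Real.exp (b n * g n).re) := by
    intro g
    rw [Complex.re_sum, Real.exp_sum, ENNReal.ofReal_prod_of_nonneg fun _ _ => (Real.exp_pos _).le]
  simp_rw [h]
  have hind : iIndepFun (fun (n : ℤ) (g : ℤ → ℂ) => ENNReal.ofReal (Real.exp (b n * g n).re))
      gaussianSequence :=
    iIndepFun_infinitePi (P := fun _ : ℤ => complexGaussian)
      (X := fun (n : ℤ) (z : ℂ) => ENNReal.ofReal (Real.exp (b n * z).re)) (fun n => by fun_prop)
  rw [lintegral_prod_eq_prod_lintegral_of_indepFun s _ hind (fun n => by fun_prop),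
    Finset.sum_div, Real.exp_sum, ENNReal.ofReal_prod_of_nonneg fun _ _ => (Real.exp_pos _).le]
  refine Finset.prod_congr rfl fun n _ => ?_
  rw [← lintegral_exp_re_mul_complexGaussian]
  exact (measurePreserving_eval_infinitePi (fun _ : ℤ => complexGaussian) n).lintegral_comp
    (f := fun z : ℂ => ENNReal.ofReal (Real.exp (b n * z).re)) (by fun_prop)

/-- Since `‖z‖ ≤ 2 max(|Re z|, |Im z|)`, one of the four exponentials dominates. This reduces the
modulus to real parts of linear forms, whose Gaussian exponential moments are explicit. -/
theorem exp_mul_norm_le {θ : ℝ} (hθ : 0 ≤ θ) (z : ℂ) :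
    Real.exp (θ * ‖z‖) ≤ Real.exp (((2 * θ : ℝ) : ℂ) * z).re + Real.exp (((-(2 * θ) : ℝ) : ℂ) * z).re
      + Real.exp ((((2 * θ : ℝ) : ℂ) * Complex.I) * z).re
      + Real.exp ((((-(2 * θ) : ℝ) : ℂ) * Complex.I) * z).re := by
  have e1 : (((2 * θ : ℝ) : ℂ) * z).re = 2 * θ * z.re := by rw [Complex.re_ofReal_mul]
  have e2 : (((-(2 * θ) : ℝ) : ℂ) * z).re = -(2 * θ * z.re) := by rw [Complex.re_ofReal_mul]; ring
  have e3 : ((((2 * θ : ℝ) : ℂ) * Complex.I) * z).re = -(2 * θ * z.im) := by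
    rw [mul_assoc, Complex.re_ofReal_mul]; simp
  have e4 : ((((-(2 * θ) : ℝ) : ℂ) * Complex.I) * z).re = 2 * θ * z.im := by
    rw [mul_assoc, Complex.re_ofReal_mul]; simp
  rw [e1, e2, e3, e4]
  have h1 : θ * ‖z‖ ≤ θ * (|z.re| + |z.im|) :=
    mul_le_mul_of_nonneg_left (Complex.norm_le_abs_re_add_abs_im z) hθ
  have p1 := Real.exp_pos (2 * θ * z.re)
  have p2 := Real.exp_pos (-(2 * θ * z.re))
  have p3 := Real.exp_pos (2 * θ * z.im)
  have p4 := Real.exp_pos (-(2 * θ * z.im))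
  rcases le_total |z.im| |z.re| with h | h
  · have h2 : θ * ‖z‖ ≤ |2 * θ * z.re| := by
      rw [abs_mul, abs_of_nonneg (by linarith : 0 ≤ 2 * θ)]
      nlinarith
    rcases abs_cases (2 * θ * z.re) with ⟨h3, -⟩ | ⟨h3, -⟩ <;> rw [h3] at h2 <;>
      have := Real.exp_le_exp.2 h2 <;> linarith
  · have h2 : θ * ‖z‖ ≤ |2 * θ * z.im| := by
      rw [abs_mul, abs_of_nonneg (by linarith : 0 ≤ 2 * θ)]
      nlinarith
    rcases abs_cases (2 * θ * z.im) with ⟨h3, -⟩ | ⟨h3, -⟩ <;> rw [h3] at h2 <;>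
      have := Real.exp_le_exp.2 h2 <;> linarith

/-- Exponential moment of the modulus of a complex Gaussian sum. -/
theorem lintegral_exp_norm_sum_le (s : Finset ℤ) (a : ℤ → ℂ) {θ : ℝ} (hθ : 0 ≤ θ) :
    ∫⁻ g, ENNReal.ofReal (Real.exp (θ * ‖∑ n ∈ s, a n * g n‖)) ∂gaussianSequence
      ≤ ENNReal.ofReal (4 * Real.exp (θ ^ 2 * ∑ n ∈ s, ‖a n‖ ^ 2)) := by
  have key : ∀ c : ℂ, ‖c‖ = 2 * θ →
      ∫⁻ g, ENNReal.ofReal (Real.exp (c * ∑ n ∈ s, a n * g n).re) ∂gaussianSequence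
        = ENNReal.ofReal (Real.exp (θ ^ 2 * ∑ n ∈ s, ‖a n‖ ^ 2)) := by
    intro c hc
    simp_rw [Finset.mul_sum, ← mul_assoc]
    rw [lintegral_exp_re_sum_gaussianSequence s fun n => c * a n]
    congr 2
    simp_rw [norm_mul, mul_pow, hc, Finset.sum_div]
    refine Finset.sum_congr rfl fun n _ => ?_
    ring
  have n1 : ‖((2 * θ : ℝ) : ℂ)‖ = 2 * θ := by
    rw [Complex.norm_real, Real.norm_of_nonneg (by linarith)]
  have n2 : ‖((-(2 * θ) : ℝ) : ℂ)‖ = 2 * θ := by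
    rw [Complex.norm_real, norm_neg, Real.norm_of_nonneg (by linarith)]
  calc _ ≤ ∫⁻ g, (ENNReal.ofReal (Real.exp (((2 * θ : ℝ) : ℂ) * ∑ n ∈ s, a n * g n).re)
          + ENNReal.ofReal (Real.exp (((-(2 * θ) : ℝ) : ℂ) * ∑ n ∈ s, a n * g n).re)
          + ENNReal.ofReal (Real.exp ((((2 * θ : ℝ) : ℂ) * Complex.I) * ∑ n ∈ s, a n * g n).re)
          + ENNReal.ofReal (Real.exp
              ((((-(2 * θ) : ℝ) : ℂ) * Complex.I) * ∑ n ∈ s, a n * g n).re)) ∂gaussianSequence := by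
        refine lintegral_mono fun g => ?_
        rw [← ENNReal.ofReal_add (by positivity) (by positivity),
          ← ENNReal.ofReal_add (by positivity) (by positivity),
          ← ENNReal.ofReal_add (by positivity) (by positivity)]
        exact ENNReal.ofReal_le_ofReal (exp_mul_norm_le hθ _)
    _ = _ := by
        rw [lintegral_add_right _ (by fun_prop), lintegral_add_right _ (by fun_prop),
          lintegral_add_right _ (by fun_prop), key _ n1, key _ n2,
          key _ (by rw [norm_mul, Complex.norm_I, mul_one, n1]),
          key _ (by rw [norm_mul, Complex.norm_I, mul_one, n2]),
          ← ENNReal.ofReal_add (by positivity) (by positivity),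
          ← ENNReal.ofReal_add (by positivity) (by positivity),
          ← ENNReal.ofReal_add (by positivity) (by positivity)]
        congr 1
        ring

/-! ### Large deviations of the `L⁴` norm of Gaussian polynomials -/

/-- The trigonometric polynomial `∑_{n ∈ s} cₙ e^{inx}`. -/
noncomputable def trigPoly (s : Finset ℤ) (c : ℤ → ℂ) (x : Torus) : ℂ :=
  ∑ n ∈ s, c n * fourier n x

/-- The integral of the fourth power of the modulus. -/
noncomputable def quartic (f : Torus → ℂ) : ℝ≥0∞ := ∫⁻ x, ‖f x‖ₑ ^ 4 ∂torusMeasure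

theorem enorm_pow_eq_ofReal (z : ℂ) (k : ℕ) : ‖z‖ₑ ^ k = ENNReal.ofReal (‖z‖ ^ k) := by
  rw [ENNReal.ofReal_pow (norm_nonneg z), ofReal_norm]

theorem measurable_trigPoly (s : Finset ℤ) (a : ℤ → ℂ) :
    Measurable fun p : (ℤ → ℂ) × Torus => trigPoly s (fun n => a n * p.1 n) p.2 := by
  refine Finset.measurable_fun_sum _ fun n _ => ?_
  refine (((measurable_pi_apply n).comp measurable_fst).const_mul _).mul ?_
  exact (fourier n).continuous.measurable.comp measurable_snd

/-- Below `t / 2` the first term suffices. Above it, `(θr)⁴ / 4! ≤ e^{θr}`, and the spare factor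
`e^{θ(r - t/2)} ≥ 1` supplies the decay in `t`. Integrated over the torus, this replaces the quartic
integral by an exponential one. -/
theorem pow_four_le_exp {r t θ : ℝ} (hr : 0 ≤ r) (ht : 0 ≤ t) (hθ : 0 < θ) :
    r ^ 4 ≤ t ^ 4 / 16 + 24 / θ ^ 4 * Real.exp (-(θ * t / 2)) * Real.exp (2 * θ * r) := by
  rcases le_total r (t / 2) with h | h
  · have : r ^ 4 ≤ (t / 2) ^ 4 := pow_le_pow_left₀ hr h 4
    have h2 : 0 ≤ 24 / θ ^ 4 * Real.exp (-(θ * t / 2)) * Real.exp (2 * θ * r) := by positivity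
    nlinarith
  · have h1 := Real.pow_div_factorial_le_exp (x := θ * r) (by positivity) 4
    have h2 : r ^ 4 ≤ 24 / θ ^ 4 * Real.exp (θ * r) := by
      rw [div_mul_eq_mul_div, le_div_iff₀ (by positivity)]
      norm_num [Nat.factorial] at h1
      nlinarith
    have h3 : Real.exp (θ * r) ≤ Real.exp (-(θ * t / 2)) * Real.exp (2 * θ * r) := by
      rw [← Real.exp_add]
      exact Real.exp_le_exp.2 (by nlinarith)
    calc r ^ 4 ≤ 24 / θ ^ 4 * Real.exp (θ * r) := h2
      _ ≤ 24 / θ ^ 4 * (Real.exp (-(θ * t / 2)) * Real.exp (2 * θ * r)) := by gcongr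
      _ ≤ _ := by rw [mul_assoc]; linarith [pow_nonneg ht 4]

/-- After Tonelli, the bound at fixed `x` does not depend on `x`, because the characters are
unimodular; the torus has total mass one. -/
theorem lintegral_exp_norm_trigPoly_le (s : Finset ℤ) (a : ℤ → ℂ) {θ : ℝ} (hθ : 0 ≤ θ) :
    ∫⁻ g, ∫⁻ x, ENNReal.ofReal (Real.exp (θ * ‖trigPoly s (fun n => a n * g n) x‖)) ∂torusMeasure
        ∂gaussianSequence
      ≤ ENNReal.ofReal (4 * Real.exp (θ ^ 2 * ∑ n ∈ s, ‖a n‖ ^ 2)) := by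
  rw [lintegral_lintegral_swap]
  · calc _ ≤ ∫⁻ _ : Torus, ENNReal.ofReal (4 * Real.exp (θ ^ 2 * ∑ n ∈ s, ‖a n‖ ^ 2))
          ∂torusMeasure := by
          refine lintegral_mono fun x => ?_
          refine le_trans (le_of_eq ?_) ((lintegral_exp_norm_sum_le s
            (fun n => a n * fourier n x) hθ).trans (le_of_eq ?_))
          · simp only [trigPoly]
            refine lintegral_congr fun g => ?_
            congr 5
            exact funext fun n => by ring
          · congr 4
            refine Finset.sum_congr rfl fun n _ => ?_
            rw [norm_mul, fourier_apply, Circle.norm_coe, mul_one]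
      _ = _ := by rw [lintegral_const, measure_univ, mul_one]
  · exact ((((measurable_trigPoly s a).norm.const_mul θ).exp).ennreal_ofReal).aemeasurable

/-- Large deviation bound for the `L⁴` norm of a Gaussian trigonometric polynomial. -/
theorem measure_le_quartic_le (s : Finset ℤ) (a : ℤ → ℂ) {t L : ℝ} (ht : 1 ≤ t) (hL : 1 ≤ L)
    (hV : 16 * L * t ^ 2 * ∑ n ∈ s, ‖a n‖ ^ 2 ≤ 1) :
    gaussianSequence {g | ENNReal.ofReal (t ^ 4) ≤ quartic (trigPoly s fun n => a n * g n)}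
      ≤ ENNReal.ofReal (128 * Real.exp (-(L * t ^ 4 / 4))) := by
  set V := ∑ n ∈ s, ‖a n‖ ^ 2 with hVdef
  -- With this `θ` the exponent is `-θt/2 + 4θ²V = -Lt⁴/2 + 4L²t⁶V`, and `hV` bounds the second term
  -- by `Lt⁴/4`.
  set θ := L * t ^ 3 with hθdef
  have hθ1 : 1 ≤ θ := one_le_mul_of_one_le_of_one_le hL (one_le_pow₀ ht)
  have hθ : 0 < θ := by linarith
  set c := 24 / θ ^ 4 * Real.exp (-(θ * t / 2)) with hc
  have hc0 : 0 ≤ c := by positivity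
  let J : (ℤ → ℂ) → ℝ≥0∞ := fun g =>
    ∫⁻ x, ENNReal.ofReal (Real.exp (2 * θ * ‖trigPoly s (fun n => a n * g n) x‖)) ∂torusMeasure
  have hJm : Measurable J := Measurable.lintegral_prod_right'
    (((measurable_trigPoly s a).norm.const_mul (2 * θ)).exp).ennreal_ofReal
  have hsub : {g | ENNReal.ofReal (t ^ 4) ≤ quartic (trigPoly s fun n => a n * g n)}
      ⊆ {g | ENNReal.ofReal (15 / 16 * t ^ 4) ≤ ENNReal.ofReal c * J g} := by
    intro g hg
    have h1 : quartic (trigPoly s fun n => a n * g n)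
        ≤ ENNReal.ofReal (t ^ 4 / 16) + ENNReal.ofReal c * J g := by
      calc _ ≤ ∫⁻ x, (ENNReal.ofReal (t ^ 4 / 16) + ENNReal.ofReal c * ENNReal.ofReal
              (Real.exp (2 * θ * ‖trigPoly s (fun n => a n * g n) x‖))) ∂torusMeasure := by
            refine lintegral_mono fun x => ?_
            rw [enorm_pow_eq_ofReal, ← ENNReal.ofReal_mul hc0,
              ← ENNReal.ofReal_add (by positivity) (by positivity)]
            exact ENNReal.ofReal_le_ofReal (pow_four_le_exp (norm_nonneg _) (by linarith) hθ)
        _ = _ := by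
            rw [lintegral_add_left measurable_const, lintegral_const, measure_univ, mul_one,
              lintegral_const_mul' _ _ ENNReal.ofReal_ne_top]
    have h2 : ENNReal.ofReal (t ^ 4)
        = ENNReal.ofReal (t ^ 4 / 16) + ENNReal.ofReal (15 / 16 * t ^ 4) := by
      rw [← ENNReal.ofReal_add (by positivity) (by positivity)]
      congr 1
      ring
    have h3 := le_trans hg h1
    rw [h2] at h3
    exact (ENNReal.add_le_add_iff_left ENNReal.ofReal_ne_top).1 h3
  refine (measure_mono hsub).trans ?_
  refine (meas_ge_le_lintegral_div (hJm.const_mul _).aemeasurable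
    (by rw [Ne, ENNReal.ofReal_eq_zero, not_le]; positivity) ENNReal.ofReal_ne_top).trans ?_
  rw [lintegral_const_mul _ hJm]
  refine (ENNReal.div_le_div_right (mul_le_mul_right (lintegral_exp_norm_trigPoly_le s a
    (θ := 2 * θ) (by positivity)) _) _).trans ?_
  rw [← ENNReal.ofReal_mul hc0, ← ENNReal.ofReal_div_of_pos (by positivity)]
  refine ENNReal.ofReal_le_ofReal ?_
  rw [div_le_iff₀ (by positivity)]
  have hexp : Real.exp (-(θ * t / 2)) * Real.exp ((2 * θ) ^ 2 * V) ≤ Real.exp (-(L * t ^ 4 / 4)) := by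
    rw [← Real.exp_add]
    refine Real.exp_le_exp.2 ?_
    have h4 : 0 ≤ L * t ^ 4 := by positivity
    have h5 : L * t ^ 4 * (16 * L * t ^ 2 * V) ≤ L * t ^ 4 * 1 := mul_le_mul_of_nonneg_left hV h4
    rw [hθdef]
    nlinarith
  have h24 : 24 / θ ^ 4 ≤ 24 := div_le_self (by norm_num) (one_le_pow₀ hθ1)
  have ht4 : 1 ≤ t ^ 4 := one_le_pow₀ ht
  calc c * (4 * Real.exp ((2 * θ) ^ 2 * V))
      = 4 * (24 / θ ^ 4) * (Real.exp (-(θ * t / 2)) * Real.exp ((2 * θ) ^ 2 * V)) := by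
        rw [hc]; ring
    _ ≤ 4 * 24 * Real.exp (-(L * t ^ 4 / 4)) := by gcongr
    -- The constant works because `96 ≤ 128 · 15/16` and `t⁴ ≥ 1`.
    _ ≤ _ := by nlinarith [Real.exp_pos (-(L * t ^ 4 / 4))]

/-! ### Norms of trigonometric polynomials and the Bernstein bound -/

/-- The trigonometric polynomial `∑_{n ∈ s} cₙ e^{inx}` as an element of `L²(𝕋)`. -/
noncomputable def trigPolyLp (s : Finset ℤ) (c : ℤ → ℂ) : L2 :=
  ∑ n ∈ s, c n • (fourierLp 2 n : L2)

theorem coeFn_trigPolyLp (s : Finset ℤ) (c : ℤ → ℂ) :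
    (trigPolyLp s c : Torus → ℂ) =ᵐ[torusMeasure] trigPoly s c := by
  have h : ∀ᵐ x ∂torusMeasure, ∀ n ∈ s, (c n • (fourierLp 2 n : L2) : L2) x = c n * fourier n x := by
    refine (ae_ball_iff s.countable_toSet).2 fun n _ => ?_
    filter_upwards [Lp.coeFn_smul (c n) (fourierLp 2 n : L2), coeFn_fourierLp (T := 2 * Real.pi) 2 n]
      with x hx hx'
    rw [hx, Pi.smul_apply, hx', smul_eq_mul]
  filter_upwards [h, Lp.coeFn_finsetSum s fun n => c n • (fourierLp 2 n : L2)] with x hx hx'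
  rw [trigPolyLp, hx', Finset.sum_apply]
  exact Finset.sum_congr rfl hx

theorem norm_trigPolyLp_sq (s : Finset ℤ) (c : ℤ → ℂ) :
    ‖trigPolyLp s c‖ ^ 2 = ∑ n ∈ s, ‖c n‖ ^ 2 := by
  have h := (orthonormal_fourier (T := 2 * Real.pi)).inner_sum c c s
  rw [trigPolyLp, ← inner_self_eq_norm_sq (𝕜 := ℂ), h]
  simp only [← Complex.normSq_eq_conj_mul_self, Complex.normSq_eq_norm_sq, RCLike.re_to_complex,
    Complex.re_sum, Complex.ofReal_re]

theorem eLpNorm_four_pow (f : Torus → ℂ) : eLpNorm f 4 torusMeasure ^ 4 = quartic f := by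
  have h := eLpNorm_nnreal_pow_eq_lintegral (f := f) (μ := torusMeasure) (p := 4) (by norm_num)
  simp only [NNReal.coe_ofNat, ENNReal.coe_ofNat, ENNReal.rpow_ofNat] at h
  exact h

theorem lintegral_enorm_trigPoly_sq (s : Finset ℤ) (c : ℤ → ℂ) :
    ∫⁻ x, ‖trigPoly s c x‖ₑ ^ 2 ∂torusMeasure = ENNReal.ofReal (∑ n ∈ s, ‖c n‖ ^ 2) := by
  have h := eLpNorm_nnreal_pow_eq_lintegral (f := trigPoly s c) (μ := torusMeasure) (p := 2)
    (by norm_num)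
  simp only [NNReal.coe_ofNat, ENNReal.coe_ofNat, ENNReal.rpow_ofNat] at h
  rw [← h, ← eLpNorm_congr_ae (coeFn_trigPolyLp s c), ← Lp.enorm_def, ← norm_trigPolyLp_sq,
    ENNReal.ofReal_pow (norm_nonneg _), ofReal_norm]

/-- Bernstein inequality for trigonometric polynomials with few frequencies. -/
theorem quartic_trigPoly_le (s : Finset ℤ) (c : ℤ → ℂ) :
    quartic (trigPoly s c) ≤ ENNReal.ofReal (s.card * (∑ n ∈ s, ‖c n‖ ^ 2) ^ 2) := by
  have hQ : 0 ≤ ∑ n ∈ s, ‖c n‖ ^ 2 := Finset.sum_nonneg fun _ _ => by positivity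
  have hpt : ∀ x, ‖trigPoly s c x‖ ^ 2 ≤ s.card * ∑ n ∈ s, ‖c n‖ ^ 2 := by
    intro x
    have h1 : ‖trigPoly s c x‖ ≤ ∑ n ∈ s, ‖c n‖ := by
      refine (norm_sum_le _ _).trans (le_of_eq (Finset.sum_congr rfl fun n _ => ?_))
      rw [norm_mul, fourier_apply, Circle.norm_coe, mul_one]
    exact (pow_le_pow_left₀ (norm_nonneg _) h1 2).trans sq_sum_le_card_mul_sum_sq
  calc quartic (trigPoly s c)
      ≤ ∫⁻ x, ENNReal.ofReal (s.card * ∑ n ∈ s, ‖c n‖ ^ 2) * ‖trigPoly s c x‖ₑ ^ 2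
          ∂torusMeasure := by
        refine lintegral_mono fun x => ?_
        rw [enorm_pow_eq_ofReal, enorm_pow_eq_ofReal, ← ENNReal.ofReal_mul (by positivity)]
        refine ENNReal.ofReal_le_ofReal ?_
        nlinarith [hpt x, sq_nonneg ‖trigPoly s c x‖]
    _ = _ := by
        rw [lintegral_const_mul' _ _ ENNReal.ofReal_ne_top, lintegral_enorm_trigPoly_sq,
          ← ENNReal.ofReal_mul (by positivity)]
        congr 1
        ring

theorem continuous_trigPoly (s : Finset ℤ) (c : ℤ → ℂ) : Continuous (trigPoly s c) :=
  continuous_finsetSum _ fun n _ => continuous_const.mul (fourier n).continuous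

theorem quartic_add_le {f g : Torus → ℂ} (hf : Measurable f) :
    quartic (fun x => f x + g x) ≤ 8 * (quartic f + quartic g) := by
  calc quartic (fun x => f x + g x) ≤ ∫⁻ x, 8 * (‖f x‖ₑ ^ 4 + ‖g x‖ₑ ^ 4) ∂torusMeasure := by
        refine lintegral_mono fun x => ?_
        simp only [enorm_pow_eq_ofReal]
        rw [← ENNReal.ofReal_add (by positivity) (by positivity),
          show (8 : ℝ≥0∞) = ENNReal.ofReal 8 by simp, ← ENNReal.ofReal_mul (by norm_num)]
        refine ENNReal.ofReal_le_ofReal ?_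
        have h := pow_le_pow_left₀ (norm_nonneg _) (norm_add_le (f x) (g x)) 4
        refine h.trans ((add_pow_le (norm_nonneg _) (norm_nonneg _) 4).trans ?_)
        norm_num
    _ = _ := by
        rw [lintegral_const_mul' _ _ (by simp), lintegral_add_left (by fun_prop)]
        rfl

/-! ### Frequency splitting and the uniform tail bound -/

/-- The terms decay like `|n|^{1/2 - 2α}`, so the threshold `α > 3/4` is precisely `2α - 1/2 > 1`.
-/
theorem summable_sqrt_div_weight_sq {α : ℝ} (hα : 3 / 4 < α) :
    Summable fun n : ℤ => √|(n : ℝ)| / weight α n ^ 2 := by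
  refine (Real.summable_abs_int_rpow (b := 2 * α - 1 / 2) (by linarith)).of_nonneg_of_le
    (fun n => by positivity) fun n => ?_
  rw [weight, Real.sq_sqrt (by positivity), div_le_iff₀ (by positivity)]
  rcases eq_or_ne n 0 with rfl | hn
  · simp only [Int.cast_zero, abs_zero, Real.sqrt_zero]
    positivity
  · have hp : 0 < |(n : ℝ)| := abs_pos.2 (Int.cast_ne_zero.2 hn)
    rw [mul_add, ← Real.rpow_add hp, Real.sqrt_eq_rpow]
    have h : -(2 * α - 1 / 2) + 2 * α = 1 / 2 := by ring
    rw [h]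
    have : 0 ≤ |(n : ℝ)| ^ (-(2 * α - 1 / 2)) := by positivity
    linarith

/-- The frequency threshold adapted to the level `k`. -/
theorem exists_frequency_cutoff {α : ℝ} (hα : 3 / 4 < α) (R : ℝ) {L : ℝ} (hL : 0 < L) :
    ∃ k₀ : ℕ, ∀ k : ℕ, k₀ ≤ k → 16 ≤ k ∧ ∃ M : ℕ, 16 * R ^ 4 * (2 * M + 1) ≤ k ∧
      ∀ s : Finset ℤ, (∀ n ∈ s, (M : ℤ) < |n|) →
        4 * L * √k * ∑ n ∈ s, 1 / weight α n ^ 2 ≤ 1 := by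
  -- With `M = ⌊k / D⌋ ≥ 1` one has `16R⁴(2M+1) ≤ 48R⁴M ≤ DM ≤ k`.
  set D : ℝ := 48 * R ^ 4 + 1 with hD
  have hR4 : 0 ≤ R ^ 4 := by positivity
  have hD1 : 1 ≤ D := by linarith
  have hε : 0 < 1 / (4 * L * √(2 * D)) := by positivity
  obtain ⟨F, hF⟩ := summable_iff_vanishing_norm.1 (summable_sqrt_div_weight_sq hα) _ hε
  obtain ⟨M₀, hM₀⟩ : ∃ M₀ : ℕ, ∀ n ∈ F, |n| ≤ (M₀ : ℤ) := by
    refine ⟨F.sup Int.natAbs, fun n hn => ?_⟩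
    have h := Finset.le_sup (f := Int.natAbs) hn
    rw [Int.abs_eq_natAbs]
    exact_mod_cast h
  refine ⟨max 16 ⌈D * (M₀ + 1)⌉₊, fun k hk => ⟨le_trans (le_max_left _ _) hk, ⌊(k : ℝ) / D⌋₊, ?_⟩⟩
  set M := ⌊(k : ℝ) / D⌋₊ with hM
  have hk1 : D * (M₀ + 1) ≤ k := (Nat.le_ceil _).trans (by exact_mod_cast (le_max_right _ _).trans hk)
  have hM1 : M₀ + 1 ≤ M := by
    refine Nat.le_floor ?_
    rw [le_div_iff₀ (by linarith)]
    push_cast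
    linarith
  have hMr : (1 : ℝ) ≤ M := by exact_mod_cast le_trans (Nat.le_add_left 1 M₀) hM1
  have hMk : D * M ≤ k := by
    have := Nat.floor_le (a := (k : ℝ) / D) (by positivity)
    rw [le_div_iff₀ (by linarith)] at this
    linarith
  -- Here `k / D ≤ M + 1 ≤ 2M`; this converse comparison turns smallness of `√M V` into smallness of
  -- `√k V`.
  have hkM : (k : ℝ) ≤ 2 * D * M := by
    have := (Nat.lt_floor_add_one ((k : ℝ) / D)).le
    rw [div_le_iff₀ (by linarith), ← hM] at this
    nlinarith
  refine ⟨by nlinarith, fun s hs => ?_⟩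
  have hdisj : Disjoint s F := by
    refine Finset.disjoint_left.2 fun n hn hn' => ?_
    have h1 := hs n hn
    have h2 := hM₀ n hn'
    omega
  have hsum := hF s hdisj
  rw [Real.norm_of_nonneg (Finset.sum_nonneg fun n _ => by positivity)] at hsum
  have hle : √M * ∑ n ∈ s, 1 / weight α n ^ 2 ≤ ∑ n ∈ s, √|(n : ℝ)| / weight α n ^ 2 := by
    rw [Finset.mul_sum]
    refine Finset.sum_le_sum fun n hn => ?_
    rw [mul_one_div]
    refine div_le_div_of_nonneg_right (Real.sqrt_le_sqrt ?_) (by positivity)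
    exact_mod_cast (hs n hn).le
  have hsq : √k ≤ √(2 * D) * √M := by
    rw [← Real.sqrt_mul (by positivity)]
    exact Real.sqrt_le_sqrt hkM
  have hV : 0 ≤ ∑ n ∈ s, 1 / weight α n ^ 2 := Finset.sum_nonneg fun n _ => by positivity
  calc 4 * L * √k * ∑ n ∈ s, 1 / weight α n ^ 2
      ≤ 4 * L * (√(2 * D) * √M) * ∑ n ∈ s, 1 / weight α n ^ 2 := by gcongr
    _ = 4 * L * √(2 * D) * (√M * ∑ n ∈ s, 1 / weight α n ^ 2) := by ring
    _ ≤ 4 * L * √(2 * D) * (1 / (4 * L * √(2 * D))) := by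
        gcongr
        exact hle.trans hsum.le
    _ = 1 := mul_one_div_cancel (by positivity)

/-- The Fourier coefficients of the random series. -/
noncomputable def randomCoeff (α : ℝ) (g : ℤ → ℂ) (n : ℤ) : ℂ := g n / (weight α n : ℂ)

/-- Uniform tail bound for the `L⁴` norm of the truncated series on an `L²` ball. -/
theorem exists_measure_tail_le {α : ℝ} (hα : 3 / 4 < α) (R : ℝ) {L : ℝ} (hL : 1 ≤ L) :
    ∃ k₀ : ℕ, ∀ k : ℕ, k₀ ≤ k → ∀ s : Finset ℤ,
      gaussianSequence {g | ‖trigPolyLp s (randomCoeff α g)‖ ≤ R ∧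
          ENNReal.ofReal k ≤ quartic (trigPoly s (randomCoeff α g))}
        ≤ ENNReal.ofReal (128 * Real.exp (-(L * k / 64))) := by
  obtain ⟨k₀, hk₀⟩ := exists_frequency_cutoff hα R (by linarith : 0 < L)
  refine ⟨k₀, fun k hk s => ?_⟩
  obtain ⟨h16, M, hM, hV⟩ := hk₀ k hk
  set A := s.filter fun n => |n| ≤ (M : ℤ) with hA
  set B := s.filter fun n => ¬ |n| ≤ (M : ℤ) with hB
  have hk16 : (16 : ℝ) ≤ k := by exact_mod_cast h16
  have hcard : (A.card : ℝ) ≤ 2 * M + 1 := by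
    have h1 : A ⊆ Finset.Icc (-(M : ℤ)) M := fun n hn =>
      Finset.mem_Icc.2 (abs_le.1 (Finset.mem_filter.1 hn).2)
    have h2 := Finset.card_le_card h1
    rw [Int.card_Icc] at h2
    have h3 : A.card ≤ 2 * M + 1 := by omega
    exact_mod_cast h3
  have hsplit : ∀ c : ℤ → ℂ, trigPoly s c = fun x => trigPoly A c x + trigPoly B c x := fun c =>
    funext fun x => (Finset.sum_filter_add_sum_filter_not s _ _).symm
  -- Chosen so that `t⁴ = k / 16`, the level left to the high frequencies; `k ≥ 16` gives `t ≥ 1`.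
  set t : ℝ := √(√k) / 2 with ht
  have ht2 : t ^ 2 = √k / 4 := by rw [ht, div_pow, Real.sq_sqrt (by positivity)]; norm_num
  have ht4 : t ^ 4 = k / 16 := by
    rw [show t ^ 4 = (t ^ 2) ^ 2 by ring, ht2, div_pow, Real.sq_sqrt (by positivity)]; norm_num
  have ht1 : 1 ≤ t := by
    rw [ht, le_div_iff₀ (by norm_num)]
    refine Real.le_sqrt_of_sq_le (Real.le_sqrt_of_sq_le ?_)
    norm_num only [one_mul]
    linarith
  have hvar : 16 * L * t ^ 2 * ∑ n ∈ B, ‖((1 / weight α n : ℝ) : ℂ)‖ ^ 2 ≤ 1 := by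
    have h1 : ∀ n, ‖((1 / weight α n : ℝ) : ℂ)‖ ^ 2 = 1 / weight α n ^ 2 := fun n => by
      rw [Complex.norm_real, Real.norm_eq_abs, sq_abs, div_pow, one_pow]
    simp_rw [h1, ht2]
    have := hV B fun n hn => not_le.1 (Finset.mem_filter.1 hn).2
    linarith
  have hbound := measure_le_quartic_le B (fun n => ((1 / weight α n : ℝ) : ℂ)) ht1 hL hvar
  rw [ht4] at hbound
  refine (measure_mono ?_).trans (hbound.trans (le_of_eq ?_))
  · rintro g ⟨hg1, hg2⟩
    have hcoeff : (fun n => ((1 / weight α n : ℝ) : ℂ) * g n) = randomCoeff α g := by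
      funext n
      rw [randomCoeff]
      push_cast
      ring
    simp only [Set.mem_ofPred_eq, hcoeff]
    have hlow : quartic (trigPoly A (randomCoeff α g)) ≤ ENNReal.ofReal (k / 16) := by
      refine (quartic_trigPoly_le A _).trans (ENNReal.ofReal_le_ofReal ?_)
      have h1 : ∑ n ∈ A, ‖randomCoeff α g n‖ ^ 2 ≤ R ^ 2 := by
        refine (Finset.sum_le_sum_of_subset_of_nonneg (Finset.filter_subset _ _)
          fun _ _ _ => by positivity).trans ?_
        rw [← norm_trigPolyLp_sq]
        exact pow_le_pow_left₀ (norm_nonneg _) hg1 2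
      have h0 : 0 ≤ ∑ n ∈ A, ‖randomCoeff α g n‖ ^ 2 := Finset.sum_nonneg fun _ _ => by positivity
      calc (A.card : ℝ) * (∑ n ∈ A, ‖randomCoeff α g n‖ ^ 2) ^ 2
          ≤ (2 * M + 1) * (R ^ 2) ^ 2 := by gcongr
        _ ≤ (k : ℝ) / 16 := by nlinarith
    rw [hsplit] at hg2
    have h8 := hg2.trans (quartic_add_le (continuous_trigPoly A _).measurable)
    have h9 : ENNReal.ofReal k ≤ 8 * (ENNReal.ofReal (k / 16)
        + quartic (trigPoly B (randomCoeff α g))) := h8.trans (by gcongr)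
    -- The low part uses up at most half of `k`, after the factor 8 from `(a+b)⁴ ≤ 8(a⁴+b⁴)`, so the
    -- high part has quartic integral at least `k / 16`.
    have h10 : ENNReal.ofReal k = 8 * (ENNReal.ofReal (k / 16) + ENNReal.ofReal (k / 16)) := by
      rw [← ENNReal.ofReal_add (by positivity) (by positivity),
        show (8 : ℝ≥0∞) = ENNReal.ofReal 8 by simp, ← ENNReal.ofReal_mul (by norm_num)]
      congr 1
      ring
    rw [h10, ENNReal.mul_le_mul_iff_right (by simp) (by simp)] at h9
    exact (ENNReal.add_le_add_iff_left ENNReal.ofReal_ne_top).1 h9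
  · congr 4
    ring

/-! ### Transfer to `γ_α` and removal of the truncation -/

/-- Convergence in `L²` implies convergence in measure, along which bounds on the `L⁴` norm persist,
so sublevel sets are closed. This also yields Borel measurability of the `L⁴` norm on `L²`. -/
theorem lowerSemicontinuous_eLpNorm_four :
    LowerSemicontinuous fun u : L2 => eLpNorm u 4 torusMeasure := by
  refine lowerSemicontinuous_iff_isClosed_preimage.2 fun y => IsSeqClosed.isClosed ?_
  intro u v hu huv
  exact eLpNorm_le_of_tendstoInMeasure (Eventually.of_forall hu)
    (tendstoInMeasure_of_tendsto_Lp huv) fun i => Lp.aestronglyMeasurable _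

theorem measurable_quartic : Measurable fun u : L2 => quartic u := by
  simp_rw [← eLpNorm_four_pow]
  exact lowerSemicontinuous_eLpNorm_four.measurable.pow_const 4

theorem normL4_pow (u : L2) : normL4 u ^ 4 = (quartic u).toReal := by
  rw [normL4, ← ENNReal.toReal_pow, eLpNorm_four_pow]

theorem fourierCoeff_eq_inner (u : L2) (n : ℤ) :
    fourierCoeff u n = inner ℂ (fourierLp 2 n : L2) u := by
  rw [← fourierBasis_repr, HilbertBasis.repr_apply_apply, coe_fourierBasis]

theorem continuous_proj (N : ℕ) : Continuous (proj N) := by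
  unfold proj
  simp_rw [fourierCoeff_eq_inner]
  fun_prop

theorem norm_proj_le (N : ℕ) (u : L2) : ‖proj N u‖ ≤ ‖u‖ := by
  refine le_of_sq_le_sq ?_ (norm_nonneg u)
  have h := norm_trigPolyLp_sq (Finset.Icc (-(N : ℤ)) N) fun n => fourierCoeff u n
  change ‖proj N u‖ ^ 2 = _ at h
  rw [h]
  simp_rw [fourierCoeff_eq_inner]
  exact (orthonormal_fourier (T := 2 * Real.pi)).sum_inner_products_le u

theorem tendsto_proj (u : L2) : Tendsto (fun N => proj N u) atTop (𝓝 u) :=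
  (hasSum_fourier_series_L2 u).comp Finset.tendsto_Icc_neg

theorem fourierCoeff_of_hasSum {c : ℤ → ℂ} {u : L2}
    (h : HasSum (fun n => c n • (fourierLp 2 n : L2)) u) (m : ℤ) : fourierCoeff u m = c m := by
  rw [fourierCoeff_eq_inner]
  have h1 := h.mapL (innerSL ℂ (fourierLp 2 m : L2))
  refine h1.unique ?_
  have ho := orthonormal_iff_ite.1 (orthonormal_fourier (T := 2 * Real.pi))
  have hf : (fun n => innerSL ℂ (fourierLp 2 m : L2) (c n • (fourierLp 2 n : L2)))
      = fun n => if n = m then c m else 0 := by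
    funext n
    rw [innerSL_apply_apply, inner_smul_right, ho]
    rcases eq_or_ne n m with rfl | hn
    · simp
    · simp [hn, hn.symm]
  rw [hf]
  exact hasSum_ite_eq m (c m)

theorem ae_proj_randomSeries {α : ℝ} (hα : 1 / 2 < α) :
    ∀ᵐ g ∂gaussianSequence, ∀ N,
      proj N (randomSeries α g) = trigPolyLp (Finset.Icc (-(N : ℤ)) N) (randomCoeff α g) := by
  filter_upwards [ae_summable hα] with g hg N
  refine Finset.sum_congr rfl fun n _ => ?_
  have h := fourierCoeff_of_hasSum (c := randomCoeff α g) (u := randomSeries α g) hg.hasSum n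
  rw [h]

theorem exists_gamma_tail_proj_le {α : ℝ} (hα : 3 / 4 < α) (R : ℝ) {β : ℝ} (hβ : 0 ≤ β) :
    ∃ K : ℝ, 0 ≤ K ∧ ∀ N k : ℕ,
      gamma α ({u | ‖proj N u‖ ≤ R} ∩ {u | (k : ℝ≥0∞) < quartic (proj N u)})
        ≤ ENNReal.ofReal (K * Real.exp (-(β * k))) := by
  have hα' : 1 / 2 < α := by linarith
  have := isProbabilityMeasure_gamma hα'
  obtain ⟨k₀, hk₀⟩ := exists_measure_tail_le hα R (L := 64 * β + 1) (by linarith)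
  -- For `k ≥ k₀` the Gaussian tail holds with constant 128, the choice of `L` making its rate at
  -- least `β`. For `k ≤ k₀` the term `e^{βk₀}` makes the bound at least one.
  refine ⟨128 + Real.exp (β * k₀), by positivity, fun N k => ?_⟩
  rcases le_total k₀ k with hk | hk
  · have hmeas : MeasurableSet
        ({u : L2 | ‖proj N u‖ ≤ R} ∩ {u | (k : ℝ≥0∞) < quartic (proj N u)}) :=
      (measurableSet_le (continuous_proj N).norm.measurable measurable_const).inter
        (measurableSet_lt measurable_const (measurable_quartic.comp (continuous_proj N).measurable))
    rw [gamma, Measure.map_apply_of_aemeasurable (aemeasurable_randomSeries hα') hmeas]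
    refine (measure_mono_ae ?_).trans
      ((hk₀ k hk (Finset.Icc (-(N : ℤ)) N)).trans (ENNReal.ofReal_le_ofReal ?_))
    · filter_upwards [ae_proj_randomSeries hα'] with g hg hmem
      obtain ⟨h1, h2⟩ := hmem
      simp only [Set.mem_ofPred_eq, hg N] at h1 h2
      have h3 : quartic (trigPolyLp (Finset.Icc (-(N : ℤ)) N) (randomCoeff α g))
          = quartic (trigPoly (Finset.Icc (-(N : ℤ)) N) (randomCoeff α g)) := by
        rw [← eLpNorm_four_pow, ← eLpNorm_four_pow, eLpNorm_congr_ae (coeFn_trigPolyLp _ _)]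
      rw [h3] at h2
      refine ⟨h1, ?_⟩
      rw [ENNReal.ofReal_natCast]
      exact h2.le
    · have h1 : Real.exp (-((64 * β + 1) * k / 64)) ≤ Real.exp (-(β * k)) :=
        Real.exp_le_exp.2 (by linarith [Nat.cast_nonneg (α := ℝ) k])
      nlinarith [Real.exp_pos (-(β * k)), Real.exp_pos (β * k₀)]
  · refine prob_le_one.trans ?_
    rw [← ENNReal.ofReal_one]
    refine ENNReal.ofReal_le_ofReal ?_
    have hk' : (k : ℝ) ≤ k₀ := by exact_mod_cast hk
    have h1 : 1 ≤ Real.exp (β * k₀) * Real.exp (-(β * k)) := by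
      rw [← Real.exp_add]
      exact Real.one_le_exp (by nlinarith)
    nlinarith [Real.exp_pos (-(β * k))]

/-- If `u` lies in the limiting event, then `Π_N u` lies in the truncated one for all large `N`:
projections do not increase the `L²` norm, and a strict lower bound on a lower semicontinuous
function is an open condition. The event is thus inside an increasing union of sets of measure at
most `b`. -/
theorem gamma_tail_le_of_proj {α R : ℝ} {k : ℕ} {b : ℝ≥0∞}
    (hb : ∀ N : ℕ,
      gamma α ({u | ‖proj N u‖ ≤ R} ∩ {u | (k : ℝ≥0∞) < quartic (proj N u)}) ≤ b) :
    gamma α ({u | ‖u‖ ≤ R} ∩ {u | (k : ℝ≥0∞) < quartic u}) ≤ b := by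
  let S : ℕ → Set L2 := fun N => {u | ‖proj N u‖ ≤ R} ∩ {u | (k : ℝ≥0∞) < quartic (proj N u)}
  let T : ℕ → Set L2 := fun N₀ => ⋂ N ≥ N₀, S N
  have hmono : Monotone T := fun i j hij =>
    Set.biInter_subset_biInter_left fun N hN => le_trans hij hN
  have hsub : {u : L2 | ‖u‖ ≤ R} ∩ {u | (k : ℝ≥0∞) < quartic u} ⊆ ⋃ N₀, T N₀ := by
    rintro u ⟨hu1, hu2⟩
    have hroot : ∀ v : L2, (k : ℝ≥0∞) < quartic v ↔
        (k : ℝ≥0∞) ^ (1 / 4 : ℝ) < eLpNorm v 4 torusMeasure := by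
      intro v
      rw [← eLpNorm_four_pow, one_div, ENNReal.rpow_inv_lt_iff (by norm_num), ENNReal.rpow_ofNat]
    have hev := (tendsto_proj u).eventually
      (lowerSemicontinuous_eLpNorm_four u _ ((hroot u).1 hu2))
    obtain ⟨N₀, hN₀⟩ := eventually_atTop.1 hev
    refine Set.mem_iUnion.2 ⟨N₀, Set.mem_iInter₂.2 fun N hN => ⟨(norm_proj_le N u).trans hu1, ?_⟩⟩
    exact (hroot _).2 (hN₀ N hN)
  refine (measure_mono hsub).trans ?_
  rw [hmono.measure_iUnion]
  exact iSup_le fun N₀ => (measure_mono (Set.biInter_subset_of_mem (le_refl N₀))).trans (hb N₀)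

/-! ### From tails to exponential integrability -/

/-- Exponential moments from tail bounds at the integers. -/
theorem setLIntegral_exp_toReal_le {Ω : Type*} [MeasurableSpace Ω] (μ : Measure Ω)
    [IsProbabilityMeasure μ] (A : Set Ω) {X : Ω → ℝ≥0∞} (hX : Measurable X) {c K : ℝ} (hc : 0 ≤ c)
    (hK : 0 ≤ K)
    (htail : ∀ k : ℕ, μ (A ∩ {ω | (k : ℝ≥0∞) < X ω})
      ≤ ENNReal.ofReal (K * Real.exp (-((c + 1) * k)))) :
    ∫⁻ ω in A, ENNReal.ofReal (Real.exp (c * (X ω).toReal)) ∂μ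
      ≤ ENNReal.ofReal (Real.exp c + ∑' k : ℕ, K * Real.exp c * Real.exp (-k)) := by
  have hms : ∀ k : ℕ, MeasurableSet {ω | (k : ℝ≥0∞) < X ω} := fun k =>
    measurableSet_lt measurable_const hX
  have hpt : ∀ ω, ENNReal.ofReal (Real.exp (c * (X ω).toReal)) ≤ ENNReal.ofReal (Real.exp c)
      + ∑' k : ℕ, {ω | (k : ℝ≥0∞) < X ω}.indicator
          (fun _ => ENNReal.ofReal (Real.exp (c * (k + 1)))) ω := by
    intro ω
    rcases le_or_gt (X ω).toReal 1 with h | h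
    -- This case includes `X ω = ∞`, where `toReal` is `0`; finiteness of `X` is not needed here.
    · exact le_add_right (ENNReal.ofReal_le_ofReal (Real.exp_le_exp.2 (by nlinarith)))
    · obtain ⟨k, hk⟩ : ∃ k : ℕ, ⌈(X ω).toReal⌉₊ = k + 1 :=
        Nat.exists_eq_succ_of_ne_zero (Nat.ceil_pos.2 (by linarith)).ne'
      have h1 : (X ω).toReal ≤ k + 1 := by
        have := Nat.le_ceil (X ω).toReal
        rw [hk] at this
        exact_mod_cast this
      have h2 : (k : ℝ) < (X ω).toReal := Nat.lt_ceil.1 (by omega)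
      have h3 : (k : ℝ≥0∞) < X ω := by
        have := (ENNReal.ofReal_lt_iff_lt_toReal (Nat.cast_nonneg k)
          (fun htop => by simp [htop] at h; linarith)).2 h2
        rwa [ENNReal.ofReal_natCast] at this
      refine le_add_left (le_trans ?_ (ENNReal.le_tsum k))
      rw [Set.indicator_of_mem (by exact h3)]
      exact ENNReal.ofReal_le_ofReal (Real.exp_le_exp.2 (mul_le_mul_of_nonneg_left h1 hc))
  have hsum : Summable fun k : ℕ => K * Real.exp c * Real.exp (-k) :=
    Real.summable_exp_neg_nat.mul_left _
  calc ∫⁻ ω in A, ENNReal.ofReal (Real.exp (c * (X ω).toReal)) ∂μ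
      ≤ ∫⁻ ω in A, (ENNReal.ofReal (Real.exp c)
        + ∑' k : ℕ, {ω | (k : ℝ≥0∞) < X ω}.indicator
          (fun _ => ENNReal.ofReal (Real.exp (c * (k + 1)))) ω) ∂μ := lintegral_mono hpt
    _ = ENNReal.ofReal (Real.exp c) * μ A
        + ∑' k : ℕ, ENNReal.ofReal (Real.exp (c * (k + 1))) * μ (A ∩ {ω | (k : ℝ≥0∞) < X ω}) := by
        rw [lintegral_add_left measurable_const, setLIntegral_const,
          lintegral_tsum fun k => (measurable_const.indicator (hms k)).aemeasurable]
        congr 2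
        funext k
        rw [lintegral_indicator_const (hms k), Measure.restrict_apply (hms k), Set.inter_comm]
    _ ≤ ENNReal.ofReal (Real.exp c) * 1
        + ∑' k : ℕ, ENNReal.ofReal (K * Real.exp c * Real.exp (-k)) := by
        -- The extra unit in the tail rate `c + 1` leaves the summable factor `e^{-k}`.
        gcongr with k
        · exact prob_le_one
        · refine (mul_le_mul_right (htail k) _).trans (le_of_eq ?_)
          rw [← ENNReal.ofReal_mul (Real.exp_pos _).le]
          congr 1
          rw [mul_left_comm, mul_assoc, ← Real.exp_add, ← Real.exp_add]
          congr 2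
          ring
    _ = _ := by
        rw [mul_one, ← ENNReal.ofReal_tsum_of_nonneg (fun k => by positivity) hsum,
          ← ENNReal.ofReal_add (by positivity) (tsum_nonneg fun k => by positivity)]

/-- Exponential integrability with a parameter of either sign, from a bound for its modulus. -/
theorem integrableOn_exp_of_setLIntegral_le {Ω : Type*} [MeasurableSpace Ω] {μ : Measure Ω}
    {A : Set Ω} {Y : Ω → ℝ} (hY : Measurable Y) (hY0 : ∀ ω, 0 ≤ Y ω) {c C : ℝ} (hC : 0 ≤ C)
    (h : ∫⁻ ω in A, ENNReal.ofReal (Real.exp (|c| * Y ω)) ∂μ ≤ ENNReal.ofReal C) :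
    IntegrableOn (fun ω => Real.exp (c * Y ω)) A μ ∧ ∫ ω in A, Real.exp (c * Y ω) ∂μ ≤ C := by
  have hle : ∫⁻ ω in A, ENNReal.ofReal (Real.exp (c * Y ω)) ∂μ ≤ ENNReal.ofReal C :=
    (lintegral_mono fun ω => ENNReal.ofReal_le_ofReal (Real.exp_le_exp.2
      (mul_le_mul_of_nonneg_right (le_abs_self c) (hY0 ω)))).trans h
  have hnn : 0 ≤ᵐ[μ.restrict A] fun ω => Real.exp (c * Y ω) :=
    ae_of_all _ fun _ => (Real.exp_pos _).le
  have hm : AEStronglyMeasurable (fun ω => Real.exp (c * Y ω)) (μ.restrict A) :=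
    (hY.const_mul c).exp.aestronglyMeasurable
  refine ⟨⟨hm, ?_⟩, ?_⟩
  · rw [hasFiniteIntegral_iff_ofReal hnn]
    exact hle.trans_lt ENNReal.ofReal_lt_top
  · rw [integral_eq_lintegral_of_nonneg_ae hnn hm]
    exact ENNReal.toReal_le_of_le_ofReal hC hle

end FractionalNLS

open FractionalNLS

theorem proposition5p7 (α lam R : ℝ) (hα : 3 / 4 < α) (hR : 0 < R) :
    (∃ C : ℝ, ∀ N : ℕ,
      Integrable
        ({u : FractionalNLS.L2 | ‖FractionalNLS.proj N u‖ ≤ R}.indicator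
          fun u => Real.exp (lam * FractionalNLS.normL4 (FractionalNLS.proj N u) ^ 4))
        (FractionalNLS.gamma α) ∧
      ∫ u, {u : FractionalNLS.L2 | ‖FractionalNLS.proj N u‖ ≤ R}.indicator
          (fun u => Real.exp (lam * FractionalNLS.normL4 (FractionalNLS.proj N u) ^ 4)) u
        ∂(FractionalNLS.gamma α) ≤ C) ∧
    (∀ᵐ u : FractionalNLS.L2 ∂(FractionalNLS.gammaTilde α R),
      MemLp (u : FractionalNLS.Torus → ℂ) 4 FractionalNLS.torusMeasure) ∧
    Integrable (fun u : FractionalNLS.L2 => Real.exp (lam * FractionalNLS.normL4 u ^ 4))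
      (FractionalNLS.gammaTilde α R) := by
  have := isProbabilityMeasure_gamma (by linarith : 1 / 2 < α)
  obtain ⟨K, hK, htail⟩ := exists_gamma_tail_proj_le hα R (β := |lam| + 1) (by positivity)
  have htail' : ∀ k : ℕ, gamma α ({u | ‖u‖ ≤ R} ∩ {u | (k : ℝ≥0∞) < quartic u})
      ≤ ENNReal.ofReal (K * Real.exp (-((|lam| + 1) * k))) := fun k =>
    gamma_tail_le_of_proj fun N => htail N k
  have hC : 0 ≤ Real.exp |lam| + ∑' k : ℕ, K * Real.exp |lam| * Real.exp (-k) :=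
    add_nonneg (Real.exp_pos _).le (tsum_nonneg fun k => by positivity)
  simp_rw [normL4_pow]
  refine ⟨⟨Real.exp |lam| + ∑' k : ℕ, K * Real.exp |lam| * Real.exp (-k), fun N => ?_⟩, ?_, ?_⟩
  rotate_left
  · have hset : MeasurableSet {u : L2 | ‖u‖ ≤ R} :=
      measurableSet_le continuous_norm.measurable measurable_const
    -- The set where the `L⁴` norm is infinite lies in every tail event, and the tail bounds tend to
    -- zero.
    have htop : gamma α ({u | ‖u‖ ≤ R} ∩ {u | quartic u = ∞}) = 0 := by
      refine le_antisymm (ge_of_tendsto' (x := atTop) (f := fun k : ℕ =>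
        ENNReal.ofReal (K * Real.exp (-((|lam| + 1) * k)))) ?_ fun k =>
          (measure_mono ?_).trans (htail' k)) bot_le
      · rw [← ENNReal.ofReal_zero, ← mul_zero K]
        refine ENNReal.tendsto_ofReal (Tendsto.const_mul K (Real.tendsto_exp_neg_atTop_nhds_zero.comp
          (tendsto_natCast_atTop_atTop.const_mul_atTop (by positivity))))
      · rintro u ⟨h1, h2⟩
        refine ⟨h1, ?_⟩
        simp only [Set.mem_ofPred_eq] at h2 ⊢
        rw [h2]
        exact ENNReal.natCast_lt_top k
    rw [gammaTilde, ae_restrict_iff' hset, ae_iff]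
    refine measure_mono_null (fun u hu => ?_) htop
    simp only [Set.mem_ofPred_eq, Classical.not_imp] at hu
    refine ⟨hu.1, ?_⟩
    by_contra hq
    refine hu.2 ⟨Lp.aestronglyMeasurable u, lt_top_iff_ne_top.2 fun h => hq ?_⟩
    simp only [Set.mem_ofPred_eq]
    rw [← eLpNorm_four_pow, h, ENNReal.top_pow (by norm_num)]
  · exact (integrableOn_exp_of_setLIntegral_le measurable_quartic.ennreal_toReal
      (fun _ => ENNReal.toReal_nonneg) hC
      (setLIntegral_exp_toReal_le _ _ measurable_quartic (abs_nonneg lam) hK htail')).1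
  · have hset : MeasurableSet {u : L2 | ‖proj N u‖ ≤ R} :=
      measurableSet_le (continuous_proj N).norm.measurable measurable_const
    have hq := measurable_quartic.comp (continuous_proj N).measurable
    rw [integrable_indicator_iff hset, integral_indicator hset]
    exact integrableOn_exp_of_setLIntegral_le hq.ennreal_toReal
      (fun _ => ENNReal.toReal_nonneg) hC
      (setLIntegral_exp_toReal_le _ _ hq (abs_nonneg lam) hK (htail N))
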